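/- Let $2<p<q<\infty$ and put $$C(p,q)=\inf_{a,c\in(0,1)}\frac{\bigl(c^{q-2}(a^{q}-1)+c^{q}(a^{2}-a^{q})+1-a^{2}\bigr)^{\frac{p-2}{q-p}}}{\bigl(c^{p-2}(a^{p}-1)+c^{p}(a^{2}-a^{p})+1-a^{2}\bigr)^{\frac{q-2}{q-p}}}\,(1-c)(1-a)(1-ac).$$ Then: (i) $C(p,q)>0$, and more precisely $$C(p,q)\ \ge\ \frac{(\min\{1,q-2\})^{\frac{p-2}{q-p}}}{p^{\frac{2(q-2)}{q-p}}}.$$ (ii) Every real or complex random variable $X$ with $\|X\|_2=1$ and $\|X\|_p<\infty$, where $\|X\|_s=(\mathbb E|X|^s)^{1/s}$, satisfies $$\|X\|_1\le 1-C(p,q)\,\frac{\bigl(\|X\|_p^p-1\bigr)^{\frac{q-2}{q-p}}}{\bigl(\|X\|_q^q-1\bigr)^{\frac{p-2}{q-p}}}.$$ Here the fraction is read as $0$ if $\|X\|_q=\infty$, and also if $|X|=1$ almost surely (when it is $0/0$). (iii) The constant is sharp, already for random variables with two values: for every real $C>C(p,q)$ there are $0<a<1<b$ and a random variable $X$ taking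 exactly the values $a$ and $b$, each with positive probability, such that $\|X\|_2=1$ and the inequality in (ii) with $C$ in place of $C(p,q)$ fails. Moreover, $C(4,6)=\tfrac13$. -/

import Mathlib

open MeasureTheory
open scoped ENNReal

noncomputable section

/-- The polynomial-type expression
`c^(s-2) (a^s - 1) + c^s (a^2 - a^s) + 1 - a^2`, for `a, c ∈ (0,1)` and `s > 2`. -/
def twoPointNum (s a c : ℝ) : ℝ :=
  c ^ (s - 2) * (a ^ s - 1) + c ^ s * (a ^ 2 - a ^ s) + 1 - a ^ 2

/-- The constant `C(p,q)`: the infimum over `a, c ∈ (0,1)` of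
`twoPointNum q a c ^ ((p-2)/(q-p)) / twoPointNum p a c ^ ((q-2)/(q-p)) * ((1-c)(1-a)(1-ac))`. -/
def sharpConst (p q : ℝ) : ℝ :=
  ⨅ x : Set.Ioo (0 : ℝ) 1 × Set.Ioo (0 : ℝ) 1,
    twoPointNum q x.1 x.2 ^ ((p - 2) / (q - p)) / twoPointNum p x.1 x.2 ^ ((q - 2) / (q - p)) *
      ((1 - (x.2 : ℝ)) * (1 - (x.1 : ℝ)) * (1 - (x.1 : ℝ) * (x.2 : ℝ)))

/-- The quotient `(‖X‖_p^p - 1)^((q-2)/(q-p)) / (‖X‖_q^q - 1)^((p-2)/(q-p))`, as an element of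
`[0,∞]`. For `‖X‖_2 = 1` both differences are nonnegative, so the truncated subtraction is the
true one. If `‖X‖_q = ∞` the quotient is `0`; if `‖X‖_p = ‖X‖_q = 1` (that is, `|X| = 1` almost
surely) the quotient `0 / 0` is `0`. -/
def momentQuotient {Ω E : Type*} [MeasurableSpace Ω] [NormedAddCommGroup E]
    (p q : ℝ) (X : Ω → E) (μ : Measure Ω) : ℝ≥0∞ :=
  (eLpNorm X (ENNReal.ofReal p) μ ^ p - 1) ^ ((q - 2) / (q - p)) /
    (eLpNorm X (ENNReal.ofReal q) μ ^ q - 1) ^ ((p - 2) / (q - p))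

end

/-! Put β = (p-2)/(q-p), so that (q-2)/(q-p) = β + 1, and for a law with second moment one let D = 1
- E|X|, A = E|X|^p - 1, B = E|X|^q - 1. The claim is C A^(β+1) ≤ D B^β. For laws on two points a < 1
< b = 1/c it holds by definition of C: the expression under the infimum is exactly D B^β / A^(β+1).
This also gives sharpness.

For general X the inequality is first linearised. Weighted AM-GM replaces it, for two-point laws, by
A ≤ M·(affine function of D and B), tangent at the values D₀, B₀ of the given X
(`le_tangent_of_mul_rpow_le`). This reads E g ≥ 0 for one explicit function g. Nonnegativity of E g
on all two-point laws of second moment one yields a multiplier ν with g(x) ≥ ν(x² - 1) for x ≥ 0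
(`exists_mul_sq_sub_one_le`). Integrating against |X| removes ν, and since the tangent was taken at
X itself, it returns the nonlinear inequality (`mul_moment_rpow_le`).

Positivity of C: both `twoPointNum p` and `twoPointNum q` are comparable to W = (1-c)(1-a)(1-ac),
and the powers of W cancel in the ratio. -/

/-! ### Two-sided comparison of `twoPointNum` with (1-c)(1-a)(1-ac) -/

lemma twoPointNum_eq {s a c : ℝ} (ha : 0 < a) (hc : 0 < c) :
    twoPointNum s a c = (1 - a ^ 2) * (1 - c ^ (s - 2)) -
      a ^ 2 * c ^ (s - 2) * (1 - a ^ (s - 2)) * (1 - c ^ 2) := by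
  have h1 : a ^ s = a ^ (s - 2) * a ^ 2 := by
    rw [← Real.rpow_natCast a 2, ← Real.rpow_add ha]; norm_num
  have h2 : c ^ s = c ^ (s - 2) * c ^ 2 := by
    rw [← Real.rpow_natCast c 2, ← Real.rpow_add hc]; norm_num
  rw [twoPointNum, h1, h2]; ring

/-- Bernoulli: `1 - x ^ t ≤ t (1 - x)` for `1 ≤ t`. -/
lemma one_sub_rpow_le {x t : ℝ} (hx : 0 < x) (ht : 1 ≤ t) : 1 - x ^ t ≤ t * (1 - x) := by
  have := one_add_mul_self_le_rpow_one_add (s := x - 1) (by linarith) ht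
  rw [show 1 + (x - 1) = x by ring] at this
  linarith

lemma le_one_sub_rpow {x t : ℝ} (hx : 0 < x) (ht0 : 0 ≤ t) (ht : t ≤ 1) :
    t * (1 - x) ≤ 1 - x ^ t := by
  have := rpow_one_add_le_one_add_mul_self (s := x - 1) (by linarith) ht0 ht
  rw [show 1 + (x - 1) = x by ring] at this
  linarith

lemma mul_one_sub_inv_rpow {x t : ℝ} (hx : 0 < x) : x ^ t * (1 - x⁻¹ ^ t) = x ^ t - 1 := by
  have : x ^ t ≠ 0 := (Real.rpow_pos_of_pos hx t).ne'
  rw [Real.inv_rpow hx.le]; field_simp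

/-- Bernoulli at x⁻¹, multiplied by x · x^t. -/
lemma mul_le_mul_one_sub_rpow {x t : ℝ} (hx : 0 < x) (ht : 1 ≤ t) :
    t * x ^ t * (1 - x) ≤ x * (1 - x ^ t) := by
  have h := one_sub_rpow_le (inv_pos.2 hx) ht
  have h2 := mul_le_mul_of_nonneg_left h (mul_pos hx (Real.rpow_pos_of_pos hx t)).le
  have h3 := mul_one_sub_inv_rpow (t := t) hx
  have h4 : x * x ^ t * (t * (1 - x⁻¹)) = t * x ^ t * (x - 1) := by field_simp
  linear_combination h2 + h4 - x * h3

lemma mul_one_sub_rpow_le {x t : ℝ} (hx : 0 < x) (ht0 : 0 ≤ t) (ht : t ≤ 1) :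
    x * (1 - x ^ t) ≤ t * x ^ t * (1 - x) := by
  have h := le_one_sub_rpow (inv_pos.2 hx) ht0 ht
  have h2 := mul_le_mul_of_nonneg_left h (mul_pos hx (Real.rpow_pos_of_pos hx t)).le
  have h3 := mul_one_sub_inv_rpow (t := t) hx
  have h4 : x * x ^ t * (t * (1 - x⁻¹)) = t * x ^ t * (x - 1) := by field_simp
  linear_combination h2 - h4 + x * h3

lemma min_mul_le_twoPointNum {s a c : ℝ} (hs : 2 < s) (ha : 0 < a) (ha1 : a < 1) (hc : 0 < c)
    (hc1 : c < 1) :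
    min 1 (s - 2) * ((1 - c) * (1 - a) * (1 - a * c)) ≤ twoPointNum s a c := by
  rw [twoPointNum_eq ha hc]
  obtain ⟨t, rfl⟩ : ∃ t, s = t + 2 := ⟨s - 2, by ring⟩
  simp only [add_sub_cancel_right]
  have ht : 0 < t := by linarith
  have hac : a * c < 1 := by nlinarith
  have hac0 : 0 < a * c := by positivity
  have hct := Real.rpow_pos_of_pos hc t
  have hat := Real.rpow_pos_of_pos ha t
  have ha' : 0 < 1 - a := by linarith
  have hc' : 0 < 1 - c := by linarith
  rcases le_total t 1 with h | h
  · rw [min_eq_right h]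
    have h1 := le_one_sub_rpow hc ht.le h
    have h2 := mul_one_sub_rpow_le ha ht.le h
    have h3 : a ^ t * c ^ t ≤ 1 :=
      mul_le_one₀ (Real.rpow_le_one ha.le ha1.le ht.le) hct.le
        (Real.rpow_le_one hc.le hc1.le ht.le)
    -- The slack: (1 + a) - a^(t+1) c^t (1 + c) exceeds 1 - ac by a(1 + c)(1 - a^t c^t).
    have h4 : 0 ≤ t * a * (1 - a) * (1 - c) * (1 + c) * (1 - a ^ t * c ^ t) := by
      have : 0 ≤ 1 - a ^ t * c ^ t := by linarith
      positivity
    have h5 := mul_le_mul_of_nonneg_left h1 (show 0 ≤ (1 - a) * (1 + a) by positivity)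
    have h6 := mul_le_mul_of_nonneg_left h2 (show 0 ≤ a * c ^ t * (1 - c) * (1 + c) by positivity)
    linear_combination h4 + h5 + h6
  · rw [min_eq_left h, one_mul]
    have h1 := mul_le_mul_one_sub_rpow hc h
    have h2 := one_sub_rpow_le ha h
    have h3 : c ^ t ≤ c := by
      simpa using Real.rpow_le_rpow_of_exponent_ge hc hc1.le h
    have h5 := mul_le_mul_of_nonneg_left h2
      (show 0 ≤ a ^ 2 * c ^ t * (1 - c) * (1 + c) by positivity)
    have h6 := mul_le_mul_of_nonneg_left h1 (show 0 ≤ a ^ 2 * (1 - a) * (1 + c) by positivity)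
    have h8 : 0 ≤ a * (1 - a * c) * (1 + c) := by
      have : 0 < 1 - a * c := by linarith
      positivity
    have h7 := mul_le_mul (show 1 - c ≤ 1 - c ^ t by linarith)
      (show 1 - a * c ≤ 1 + a - a ^ 2 * c * (1 + c) by nlinarith) (by linarith) (by linarith)
    have h9 := mul_le_mul_of_nonneg_left h7 ha'.le
    linear_combination h5 + h6 + h9

/-- The second derivative is k(k-1)(u^(k-2) - 1) ≤ 0. Hence convexity gaps of u^k on [0,1] are at
most k(k-1)/2 times those of u². -/
lemma concaveOn_rpow_sub_sq {k : ℝ} (hk : 2 ≤ k) :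
    ConcaveOn ℝ (Set.Icc 0 1) fun u : ℝ => u ^ k - k * (k - 1) / 2 * u ^ 2 := by
  have hd : ∀ x : ℝ, HasDerivAt (fun u : ℝ => u ^ k - k * (k - 1) / 2 * u ^ 2)
      (k * x ^ (k - 1) - k * (k - 1) * x) x := fun x => by
    have h1 := Real.hasDerivAt_rpow_const (x := x) (p := k) (Or.inr (by linarith))
    have h2 := (hasDerivAt_pow 2 x).const_mul (k * (k - 1) / 2)
    refine (h1.sub h2).congr_deriv ?_
    push_cast; ring
  have hd2 : ∀ x : ℝ, HasDerivAt (fun x : ℝ => k * x ^ (k - 1) - k * (k - 1) * x)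
      (k * ((k - 1) * x ^ (k - 1 - 1)) - k * (k - 1) * 1) x := fun x =>
    ((Real.hasDerivAt_rpow_const (x := x) (p := k - 1) (Or.inr (by linarith))).const_mul k).sub
      ((hasDerivAt_id x).const_mul _)
  refine concaveOn_of_hasDerivWithinAt2_nonpos (convex_Icc 0 1)
    (fun x _ => (hd x).continuousAt.continuousWithinAt) (fun x _ => (hd x).hasDerivWithinAt)
    (fun x _ => (hd2 x).hasDerivWithinAt) ?_
  intro x hx
  rw [interior_Icc] at hx
  have : x ^ (k - 1 - 1) ≤ 1 := Real.rpow_le_one hx.1.le hx.2.le (by linarith)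
  have h0 : 0 ≤ k * (k - 1) := by nlinarith
  nlinarith

/-- Up to the factor 1 - (ac)², c² `twoPointNum s a c` is the convexity gap of u^(s/2) at c², a
convex combination of (ac)² and 1. The gap of u² factors completely, which gives the constant
s(s-2)/8; the three factors 1 + a, 1 + c, 1 + ac then cost at most 8. -/
lemma twoPointNum_le_of_six_le {s a c : ℝ} (hs : 6 ≤ s) (ha : 0 < a) (ha1 : a < 1) (hc : 0 < c)
    (hc1 : c < 1) :
    twoPointNum s a c ≤ s ^ 2 * ((1 - c) * (1 - a) * (1 - a * c)) := by
  have hac : a * c < 1 := by nlinarith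
  have hac0 : 0 < a * c := by positivity
  have ha' : 0 < 1 - a := by linarith
  have hc' : 0 < 1 - c := by linarith
  have hac' : 0 < 1 - a * c := by linarith
  have hden : 0 < 1 - (a * c) ^ 2 := by nlinarith
  have hsq : ∀ x : ℝ, 0 < x → (x ^ 2) ^ (s / 2) = x ^ s := fun x hx => by
    rw [← Real.rpow_natCast x 2, ← Real.rpow_mul hx.le]; congr 1; push_cast; ring
  have hcs : c ^ s = c ^ (s - 2) * c ^ 2 := by
    rw [← Real.rpow_natCast c 2, ← Real.rpow_add hc]; norm_num
  have hx : (a * c) ^ 2 ∈ Set.Icc (0 : ℝ) 1 := ⟨by positivity, by nlinarith⟩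
  have hw₁ : 0 ≤ (1 - c ^ 2) / (1 - (a * c) ^ 2) := div_nonneg (by nlinarith) hden.le
  have hw₂ : 0 ≤ (c ^ 2 - (a * c) ^ 2) / (1 - (a * c) ^ 2) :=
    div_nonneg (by nlinarith [mul_pos (mul_pos hc hc) (show 0 < 1 - a ^ 2 by nlinarith)]) hden.le
  have hw : (1 - c ^ 2) / (1 - (a * c) ^ 2) + (c ^ 2 - (a * c) ^ 2) / (1 - (a * c) ^ 2) = 1 := by
    rw [← add_div, div_eq_one_iff_eq hden.ne']; ring
  have h := (concaveOn_rpow_sub_sq (k := s / 2) (by linarith)).2 hx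
    (Set.right_mem_Icc.2 zero_le_one) hw₁ hw₂ hw
  have hpt : (1 - c ^ 2) / (1 - (a * c) ^ 2) * (a * c) ^ 2 +
      (c ^ 2 - (a * c) ^ 2) / (1 - (a * c) ^ 2) = c ^ 2 := by
    rw [div_mul_eq_mul_div, ← add_div, div_eq_iff hden.ne']; ring
  simp only [smul_eq_mul, mul_one] at h
  rw [hpt, hsq _ hac0, hsq _ hc, Real.mul_rpow ha.le hc.le, Real.one_rpow] at h
  have h2 := mul_le_mul_of_nonneg_left h hden.le
  have h3 : (1 - (a * c) ^ 2) * ((1 - c ^ 2) / (1 - (a * c) ^ 2) *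
        (a ^ s * c ^ s - s / 2 * (s / 2 - 1) / 2 * ((a * c) ^ 2) ^ 2) +
      (c ^ 2 - (a * c) ^ 2) / (1 - (a * c) ^ 2) * (1 - s / 2 * (s / 2 - 1) / 2 * 1 ^ 2)) =
      (1 - c ^ 2) * (a ^ s * c ^ s - s / 2 * (s / 2 - 1) / 2 * ((a * c) ^ 2) ^ 2) +
      (c ^ 2 - (a * c) ^ 2) * (1 - s / 2 * (s / 2 - 1) / 2 * 1 ^ 2) := by
    rw [mul_add, ← mul_assoc, ← mul_assoc, mul_div_cancel₀ _ hden.ne', mul_div_cancel₀ _ hden.ne']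
  rw [h3, hcs] at h2
  have h4 : c ^ 2 * twoPointNum s a c ≤
      c ^ 2 * (s * (s - 2) / 8 * ((1 - a ^ 2) * (1 - c ^ 2) * (1 - (a * c) ^ 2))) := by
    rw [twoPointNum, hcs]; linear_combination h2
  refine (le_of_mul_le_mul_left h4 (by positivity)).trans ?_
  have h5 : (1 + a) * (1 + c) * (1 + a * c) ≤ 8 := by
    have : (1 + a) * (1 + c) ≤ 2 * 2 := by gcongr <;> linarith
    have : (1 + a) * (1 + c) * (1 + a * c) ≤ (2 * 2) * 2 := by gcongr; linarith
    linarith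
  have h6 := mul_le_mul_of_nonneg_left h5
    (show 0 ≤ s * (s - 2) / 8 * ((1 - c) * (1 - a) * (1 - a * c)) by
      have : 0 ≤ s - 2 := by linarith
      positivity)
  have h7 : 0 ≤ 2 * s * ((1 - c) * (1 - a) * (1 - a * c)) := by positivity
  linear_combination h6 + h7

lemma twoPointNum_le {s a c : ℝ} (hs : 2 < s) (ha : 0 < a) (ha1 : a < 1) (hc : 0 < c)
    (hc1 : c < 1) :
    twoPointNum s a c ≤ s ^ 2 * ((1 - c) * (1 - a) * (1 - a * c)) := by
  -- The Bernoulli argument below ends with t(2t+1) ≤ (t+2)², which for t > 0 means t ≤ 4, that is s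
  -- ≤ 6.
  rcases le_total 6 s with h6 | h6
  · exact twoPointNum_le_of_six_le h6 ha ha1 hc hc1
  rw [twoPointNum_eq ha hc]
  obtain ⟨t, rfl⟩ : ∃ t, s = t + 2 := ⟨s - 2, by ring⟩
  simp only [add_sub_cancel_right]
  have ht : 0 < t := by linarith
  have hac : a * c < 1 := by nlinarith
  have hac0 : 0 < a * c := by positivity
  have hac' : 0 < 1 - a * c := by linarith
  have hct := Real.rpow_pos_of_pos hc t
  have hat := Real.rpow_pos_of_pos ha t
  have ha' : 0 < 1 - a := by linarith
  have hc' : 0 < 1 - c := by linarith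
  have hW : 0 < (1 - c) * (1 - a) * (1 - a * c) := by positivity
  rcases le_total t 1 with h | h
  · have h1 := mul_one_sub_rpow_le hc ht.le h
    have h2 := le_one_sub_rpow ha ht.le h
    have h3 : c ≤ c ^ t := by
      simpa using Real.rpow_le_rpow_of_exponent_ge hc hc1.le h
    have h5 := mul_le_mul_of_nonneg_left h2
      (show 0 ≤ a ^ 2 * c ^ t * (1 - c) * (1 + c) by positivity)
    have h6 := mul_le_mul_of_nonneg_left h1 (show 0 ≤ a ^ 2 * (1 - a) * (1 + c) by positivity)
    have h7 := mul_le_mul (show 1 - c ^ t ≤ 1 - c by linarith)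
      (show 1 + a - a ^ 2 * c * (1 + c) ≤ 3 * (1 - a * c) by nlinarith)
      (by nlinarith [mul_pos ha hac', mul_pos hac0 hac']) hc'.le
    have h9 := mul_le_mul_of_nonneg_left h7 ha'.le
    have h10 := mul_le_mul_of_nonneg_right (show 3 ≤ (t + 2) ^ 2 by nlinarith) hW.le
    linear_combination h5 + h6 + h9 + h10
  · have h1 := one_sub_rpow_le hc h
    have h2 := mul_le_mul_one_sub_rpow ha h
    have h3 := one_sub_rpow_le hac0 h
    have h3' := one_sub_rpow_le hac0 (show 1 ≤ t + 1 by linarith)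
    rw [Real.rpow_add_one hac0.ne'] at h3'
    rw [Real.mul_rpow ha.le hc.le] at h3 h3'
    have h5 := mul_le_mul_of_nonneg_left h1 (show 0 ≤ (1 - a) * (1 + a) by positivity)
    have h6 := mul_le_mul_of_nonneg_left h2 (show 0 ≤ a * c ^ t * (1 - c) * (1 + c) by positivity)
    have h7 : 1 + a - a * (a ^ t * c ^ t) * (1 + c) ≤ (2 * t + 1) * (1 - a * c) := by
      have h8 := mul_le_mul_of_nonneg_left h3 ha.le
      have h9 : a * (t * (1 - a * c)) ≤ 1 * (t * (1 - a * c)) := by gcongr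
      linear_combination h8 + h9 + h3'
    have h9 := mul_le_mul_of_nonneg_left h7 (show 0 ≤ t * (1 - a) * (1 - c) by positivity)
    have h10 := mul_le_mul_of_nonneg_right (show t * (2 * t + 1) ≤ (t + 2) ^ 2 by nlinarith) hW.le
    linear_combination h5 + h6 + h9 + h10

lemma twoPointNum_pos {s a c : ℝ} (hs : 2 < s) (ha : 0 < a) (ha1 : a < 1) (hc : 0 < c)
    (hc1 : c < 1) : 0 < twoPointNum s a c := by
  refine lt_of_lt_of_le ?_ (min_mul_le_twoPointNum hs ha ha1 hc hc1)
  have hac : 0 < 1 - a * c := by nlinarith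
  have ha' : 0 < 1 - a := by linarith
  have hc' : 0 < 1 - c := by linarith
  have : 0 < min 1 (s - 2) := lt_min one_pos (by linarith)
  positivity

/-! ### Lower bound and positivity of the constant -/

lemma twoPoint_ratio_ge {p q a c : ℝ} (hp : 2 < p) (hpq : p < q) (ha : 0 < a) (ha1 : a < 1)
    (hc : 0 < c) (hc1 : c < 1) :
    (min 1 (q - 2)) ^ ((p - 2) / (q - p)) / p ^ (2 * (q - 2) / (q - p)) ≤
      twoPointNum q a c ^ ((p - 2) / (q - p)) / twoPointNum p a c ^ ((q - 2) / (q - p)) *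
        ((1 - c) * (1 - a) * (1 - a * c)) := by
  have hac : 0 < 1 - a * c := by nlinarith
  have ha' : 0 < 1 - a := by linarith
  have hc' : 0 < 1 - c := by linarith
  have hm : 0 < min 1 (q - 2) := lt_min one_pos (by linarith)
  have hlow := min_mul_le_twoPointNum (hp.trans hpq) ha ha1 hc hc1
  have hup := twoPointNum_le hp ha ha1 hc hc1
  have hpos := twoPointNum_pos hp ha ha1 hc hc1
  set W := (1 - c) * (1 - a) * (1 - a * c) with hWdef
  have hW : 0 < W := by positivity
  have hqp : 0 < q - p := by linarith
  set β := (p - 2) / (q - p) with hβ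
  have hβ0 : 0 ≤ β := div_nonneg (by linarith) hqp.le
  have hα : (q - 2) / (q - p) = β + 1 := by rw [hβ]; field_simp; ring
  have hα2 : 2 * (q - 2) / (q - p) = 2 * (β + 1) := by rw [← hα]; ring
  rw [hα2, hα]
  calc (min 1 (q - 2)) ^ β / p ^ (2 * (β + 1))
      = (min 1 (q - 2) * W) ^ β / (p ^ 2 * W) ^ (β + 1) * W := by
        rw [Real.mul_rpow hm.le hW.le, Real.mul_rpow (by positivity) hW.le,
          Real.rpow_add_one hW.ne', Real.rpow_mul (by linarith), Real.rpow_two]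
        have := (Real.rpow_pos_of_pos hW β).ne'
        field_simp
    _ ≤ _ := by
        have : 0 < twoPointNum q a c := lt_of_lt_of_le (by positivity) hlow
        gcongr

instance : Nonempty (Set.Ioo (0 : ℝ) 1) := ⟨⟨1 / 2, by norm_num, by norm_num⟩⟩

lemma le_sharpConst {p q : ℝ} (hp : 2 < p) (hpq : p < q) :
    (min 1 (q - 2)) ^ ((p - 2) / (q - p)) / p ^ (2 * (q - 2) / (q - p)) ≤ sharpConst p q :=
  le_ciInf fun x => twoPoint_ratio_ge hp hpq x.1.2.1 x.1.2.2 x.2.2.1 x.2.2.2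

lemma sharpConst_pos {p q : ℝ} (hp : 2 < p) (hpq : p < q) : 0 < sharpConst p q := by
  have : 0 < min 1 (q - 2) := lt_min one_pos (by linarith)
  have : 0 < p := by linarith
  exact lt_of_lt_of_le (by positivity) (le_sharpConst hp hpq)

lemma bddBelow_twoPoint_ratio {p q : ℝ} (hp : 2 < p) (hpq : p < q) :
    BddBelow (Set.range fun x : Set.Ioo (0 : ℝ) 1 × Set.Ioo (0 : ℝ) 1 =>
      twoPointNum q x.1 x.2 ^ ((p - 2) / (q - p)) / twoPointNum p x.1 x.2 ^ ((q - 2) / (q - p)) *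
        ((1 - (x.2 : ℝ)) * (1 - (x.1 : ℝ)) * (1 - (x.1 : ℝ) * (x.2 : ℝ)))) :=
  ⟨_, Set.forall_mem_range.2 fun x =>
    twoPoint_ratio_ge hp hpq x.1.2.1 x.1.2.2 x.2.2.1 x.2.2.2⟩

lemma sharpConst_le {p q a c : ℝ} (hp : 2 < p) (hpq : p < q) (ha : 0 < a) (ha1 : a < 1)
    (hc : 0 < c) (hc1 : c < 1) :
    sharpConst p q ≤
      twoPointNum q a c ^ ((p - 2) / (q - p)) / twoPointNum p a c ^ ((q - 2) / (q - p)) *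
        ((1 - c) * (1 - a) * (1 - a * c)) :=
  ciInf_le (bddBelow_twoPoint_ratio hp hpq) (⟨a, ha, ha1⟩, ⟨c, hc, hc1⟩)

/-! ### The exponents 4 and 6 -/

lemma twoPoint_ratio_four_six {a c : ℝ} (ha : 0 < a) (ha1 : a < 1) (hc : 0 < c) (hc1 : c < 1) :
    twoPointNum 6 a c ^ (((4 : ℝ) - 2) / (6 - 4)) / twoPointNum 4 a c ^ (((6 : ℝ) - 2) / (6 - 4)) *
        ((1 - c) * (1 - a) * (1 - a * c)) =
      (1 + c ^ 2 + a ^ 2 * c ^ 2) / ((1 + a) * (1 + c) * (1 + a * c)) := by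
  have h4 : twoPointNum 4 a c = (1 - a ^ 2) * (1 - c ^ 2) * (1 - a ^ 2 * c ^ 2) := by
    have e : (4 : ℝ) - 2 = (2 : ℕ) := by norm_num
    rw [twoPointNum_eq ha hc, e, Real.rpow_natCast, Real.rpow_natCast]; ring
  have h6 : twoPointNum 6 a c =
      (1 + c ^ 2 + a ^ 2 * c ^ 2) * ((1 - a ^ 2) * (1 - c ^ 2) * (1 - a ^ 2 * c ^ 2)) := by
    have e : (6 : ℝ) - 2 = (4 : ℕ) := by norm_num
    rw [twoPointNum_eq ha hc, e, Real.rpow_natCast, Real.rpow_natCast]; ring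
  have e1 : ((4 : ℝ) - 2) / (6 - 4) = 1 := by norm_num
  have e2 : ((6 : ℝ) - 2) / (6 - 4) = (2 : ℕ) := by norm_num
  rw [e1, e2, Real.rpow_one, Real.rpow_natCast, h4, h6]
  have hac : 0 < 1 - a * c := by nlinarith
  have ha' : 0 < 1 - a := by linarith
  have hc' : 0 < 1 - c := by linarith
  rw [show (1 - a ^ 2) * (1 - c ^ 2) * (1 - a ^ 2 * c ^ 2) =
    ((1 - a) * (1 - c) * (1 - a * c)) * ((1 + a) * (1 + c) * (1 + a * c)) by ring]
  rw [div_mul_eq_mul_div, div_eq_div_iff (by positivity) (by positivity)]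
  ring

lemma sharpConst_four_six : sharpConst 4 6 = 1 / 3 := by
  apply le_antisymm
  -- The value 1/3 is approached at c = 1/2 as a → 1.
  · have hlim : Filter.Tendsto (fun a : ℝ => (1 + (1 / 2) ^ 2 + a ^ 2 * (1 / 2) ^ 2) /
        ((1 + a) * (1 + 1 / 2) * (1 + a * (1 / 2)))) (nhdsWithin 1 (Set.Iio 1))
        (nhds (1 / 3)) := by
      have : ContinuousAt (fun a : ℝ => (1 + (1 / 2) ^ 2 + a ^ 2 * (1 / 2) ^ 2) /
        ((1 + a) * (1 + 1 / 2) * (1 + a * (1 / 2)))) 1 := by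
        apply ContinuousAt.div (by fun_prop) (by fun_prop); norm_num
      have h := this.tendsto.mono_left (nhdsWithin_le_nhds (s := Set.Iio 1))
      norm_num at h ⊢; exact h
    refine ge_of_tendsto hlim ?_
    filter_upwards [Ioo_mem_nhdsLT (show (0 : ℝ) < 1 by norm_num)] with a ha
    have := sharpConst_le (p := 4) (q := 6) (c := 1 / 2) (by norm_num) (by norm_num) ha.1 ha.2
      (by norm_num) (by norm_num)
    rwa [twoPoint_ratio_four_six ha.1 ha.2 (by norm_num) (by norm_num)] at this
  · refine le_ciInf fun x => ?_
    obtain ⟨⟨a, ha, ha1⟩, c, hc, hc1⟩ := x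
    simp only
    rw [twoPoint_ratio_four_six ha ha1 hc hc1, div_le_div_iff₀ (by norm_num) (by positivity)]
    -- 3(1 + c² + a²c²) - (1+a)(1+c)(1+ac) is this term plus its value (2c - 1)² at a = 1.
    have h1 : 0 ≤ (1 - a) * ((1 + c) ^ 2 - (1 + a) * (2 * c ^ 2 - c)) := by
      apply mul_nonneg (by linarith)
      rcases le_total (2 * c ^ 2 - c) 0 with h | h
      · nlinarith
      · nlinarith
    nlinarith [sq_nonneg (2 * c - 1)]

/-! ### Lagrange multiplier and linearisation -/

/-- A function nonnegative on average over all two-point laws of second moment one dominates a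
multiple of `x ^ 2 - 1`. -/
lemma exists_mul_sq_sub_one_le {g : ℝ → ℝ} (hg0 : ContinuousAt g 0) (hg1 : 0 ≤ g 1)
    (h : ∀ a b : ℝ, 0 < a → a < 1 → 1 < b → 0 ≤ g a * (b ^ 2 - 1) + g b * (1 - a ^ 2)) :
    ∃ ν : ℝ, ∀ x, 0 ≤ x → ν * (x ^ 2 - 1) ≤ g x := by
  have key : ∀ a b : ℝ, 0 < a → a < 1 → 1 < b → -g a / (1 - a ^ 2) ≤ g b / (b ^ 2 - 1) := by
    intro a b ha ha1 hb
    rw [div_le_div_iff₀ (by nlinarith) (by nlinarith)]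
    linarith [h a b ha ha1 hb]
  -- The multiplier is the infimum of these slopes over b > 1; by `key` it lies above every slope
  -- coming from a < 1.
  set S : Set ℝ := (fun b : ℝ => g b / (b ^ 2 - 1)) '' Set.Ioi 1
  have hSne : S.Nonempty := ⟨_, 2, by norm_num [Set.mem_Ioi], rfl⟩
  have hSbdd : BddBelow S := by
    refine ⟨-g (1 / 2) / (1 - (1 / 2) ^ 2), ?_⟩
    rintro _ ⟨b, hb, rfl⟩
    exact key _ b (by norm_num) (by norm_num) hb
  have hpos : ∀ x, 0 < x → x < 1 → sInf S * (x ^ 2 - 1) ≤ g x := by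
    intro x hx hx1
    have : -g x / (1 - x ^ 2) ≤ sInf S := by
      refine le_csInf hSne ?_
      rintro _ ⟨b, hb, rfl⟩
      exact key x b hx hx1 hb
    rw [div_le_iff₀ (by nlinarith)] at this
    linarith
  refine ⟨sInf S, fun x hx => ?_⟩
  -- The two-point hypothesis has a > 0, so x = 0 is reached by continuity.
  rcases hx.eq_or_lt with rfl | hx
  · have h1 : Filter.Tendsto (fun x : ℝ => sInf S * (x ^ 2 - 1)) (nhdsWithin 0 (Set.Ioi 0))
        (nhds (sInf S * (0 ^ 2 - 1))) :=
      (Continuous.tendsto (by fun_prop) 0).mono_left nhdsWithin_le_nhds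
    refine le_of_tendsto_of_tendsto h1 (hg0.tendsto.mono_left nhdsWithin_le_nhds) ?_
    filter_upwards [Ioo_mem_nhdsGT (show (0 : ℝ) < 1 by norm_num)] with x hx
    exact hpos x hx.1 hx.2
  rcases lt_trichotomy x 1 with h1 | rfl | h1
  · exact hpos x hx h1
  · simpa using hg1
  · have : sInf S ≤ g x / (x ^ 2 - 1) := csInf_le hSbdd ⟨x, h1, rfl⟩
    rwa [le_div_iff₀ (by nlinarith)] at this

/-- The tangent-plane form of `C A ^ (β + 1) ≤ D B ^ β`. -/
lemma le_tangent_of_mul_rpow_le {A B D C β B₀ D₀ : ℝ} (hA : 0 ≤ A) (hB : 0 ≤ B) (hD : 0 ≤ D)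
    (hC : 0 < C) (hβ : 0 ≤ β) (hB₀ : 0 < B₀) (hD₀ : 0 < D₀)
    (h : C * A ^ (β + 1) ≤ D * B ^ β) :
    A ≤ (D₀ * B₀ ^ β / C) ^ (1 / (β + 1)) * (1 / (β + 1) * (D / D₀) + β / (β + 1) * (B / B₀)) := by
  have hβ1 : 0 < β + 1 := by linarith
  have hM : 0 < D₀ * B₀ ^ β / C := by positivity
  have amgm := Real.geom_mean_le_arith_mean2_weighted (w₁ := 1 / (β + 1)) (w₂ := β / (β + 1))
    (by positivity) (by positivity) (show 0 ≤ D / D₀ by positivity) (show 0 ≤ B / B₀ by positivity)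
    (by field_simp; ring)
  refine le_trans ?_ (mul_le_mul_of_nonneg_left amgm (by positivity))
  have e : (B / B₀) ^ (β / (β + 1)) = ((B / B₀) ^ β) ^ (1 / (β + 1)) := by
    rw [← Real.rpow_mul (by positivity)]; congr 1; ring
  rw [e, ← Real.mul_rpow (by positivity) (by positivity),
    ← Real.mul_rpow (by positivity) (by positivity)]
  rw [Real.div_rpow hB hB₀.le]
  have e2 : D₀ * B₀ ^ β / C * (D / D₀ * (B ^ β / B₀ ^ β)) = D * B ^ β / C := by
    have := (Real.rpow_pos_of_pos hB₀ β).ne'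
    field_simp
  rw [e2]
  have e3 : A = (A ^ (β + 1)) ^ (1 / (β + 1)) := by
    rw [← Real.rpow_mul hA, mul_one_div_cancel hβ1.ne', Real.rpow_one]
  conv_lhs => rw [e3]
  apply Real.rpow_le_rpow (by positivity) _ (by positivity)
  rw [le_div_iff₀ hC]; linarith

/-! ### Two-point laws and the passage to general laws -/

/-- `E X ^ s - 1` for the two-point law on `{a, c⁻¹}` of second moment one. -/
lemma twoPoint_moment_sub_one {s a c : ℝ} (ha : 0 < a) (ha1 : a < 1) (hc : 0 < c) (hc1 : c < 1) :
    a ^ s * (c⁻¹ ^ 2 - 1) + c⁻¹ ^ s * (1 - a ^ 2) - (c⁻¹ ^ 2 - a ^ 2) =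
      (c⁻¹ ^ 2 - a ^ 2) * (c⁻¹ ^ (s - 2) * twoPointNum s a c / (1 - a ^ 2 * c ^ 2)) := by
  have hac : 0 < 1 - a ^ 2 * c ^ 2 := by nlinarith [mul_pos ha hc, show a * c < 1 by nlinarith]
  have h1 : a ^ s = a ^ (s - 2) * a ^ 2 := by
    rw [← Real.rpow_natCast a 2, ← Real.rpow_add ha]; norm_num
  have h2 : c⁻¹ ^ s = c⁻¹ ^ (s - 2) * c⁻¹ ^ 2 := by
    rw [← Real.rpow_natCast c⁻¹ 2, ← Real.rpow_add (inv_pos.2 hc)]; norm_num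
  have := (Real.rpow_pos_of_pos hc (s - 2)).ne'
  rw [twoPointNum_eq ha hc, h1, h2, Real.inv_rpow hc.le]
  field_simp
  ring

/-- This is 1 - E X, with the weights of the law on {a, c⁻¹} cleared of their denominator c⁻² - a².
-/
lemma twoPoint_one_sub_mean {a c : ℝ} (ha : 0 < a) (ha1 : a < 1) (hc : 0 < c) (hc1 : c < 1) :
    (1 - a) * (c⁻¹ ^ 2 - 1) + (1 - c⁻¹) * (1 - a ^ 2) =
      (c⁻¹ ^ 2 - a ^ 2) * ((1 - c) * (1 - a) * (1 - a * c) / (1 - a ^ 2 * c ^ 2)) := by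
  have hac : 0 < 1 - a ^ 2 * c ^ 2 := by nlinarith [mul_pos ha hc, show a * c < 1 by nlinarith]
  field_simp
  ring

/-- For the two-point law on `{a, c⁻¹}`, the quantity minimised in `sharpConst` is
`(1 - E X) (E X ^ q - 1) ^ β / (E X ^ p - 1) ^ α`. -/
lemma twoPoint_ratio_eq {p q a c : ℝ} (hp : 2 < p) (hpq : p < q) (ha : 0 < a) (ha1 : a < 1)
    (hc : 0 < c) (hc1 : c < 1) :
    twoPointNum q a c ^ ((p - 2) / (q - p)) / twoPointNum p a c ^ ((q - 2) / (q - p)) *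
        ((1 - c) * (1 - a) * (1 - a * c)) *
      (c⁻¹ ^ (p - 2) * twoPointNum p a c / (1 - a ^ 2 * c ^ 2)) ^ ((q - 2) / (q - p)) =
      (1 - c) * (1 - a) * (1 - a * c) / (1 - a ^ 2 * c ^ 2) *
        (c⁻¹ ^ (q - 2) * twoPointNum q a c / (1 - a ^ 2 * c ^ 2)) ^ ((p - 2) / (q - p)) := by
  have hac : 0 < 1 - a ^ 2 * c ^ 2 := by nlinarith [mul_pos ha hc, show a * c < 1 by nlinarith]
  have hNp := twoPointNum_pos hp ha ha1 hc hc1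
  have hNq := twoPointNum_pos (hp.trans hpq) ha ha1 hc hc1
  have hqp : 0 < q - p := by linarith
  have hb : 0 < c⁻¹ := inv_pos.2 hc
  have e1 : ∀ s : ℝ, 0 ≤ c⁻¹ ^ (s - 2) := fun s => by positivity
  have hα : (q - 2) / (q - p) = (p - 2) / (q - p) + 1 := by field_simp; ring
  rw [Real.div_rpow (by positivity) hac.le, Real.div_rpow (by positivity) hac.le,
    Real.mul_rpow (e1 p) hNp.le, Real.mul_rpow (e1 q) hNq.le, ← Real.rpow_mul hb.le,
    ← Real.rpow_mul hb.le,
    -- The powers of c⁻¹ on the two sides agree and cancel.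
    show (p - 2) * ((q - 2) / (q - p)) = (q - 2) * ((p - 2) / (q - p)) by ring]
  have h1 := (Real.rpow_pos_of_pos hNp ((q - 2) / (q - p))).ne'
  have h2 := (Real.rpow_pos_of_pos hac ((p - 2) / (q - p))).ne'
  have h3 : (1 - a ^ 2 * c ^ 2) ^ ((q - 2) / (q - p)) =
      (1 - a ^ 2 * c ^ 2) ^ ((p - 2) / (q - p)) * (1 - a ^ 2 * c ^ 2) := by
    rw [hα, Real.rpow_add_one hac.ne']
  rw [h3]
  field_simp

/-- Up to the positive factor b² - a², the sum is the mean of g, i.e. the tangent bound minus A. The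
infimum defining `sharpConst` supplies the hypothesis of `le_tangent_of_mul_rpow_le`. -/
lemma twoPoint_tangent {p q B₀ D₀ a b : ℝ} (hp : 2 < p) (hpq : p < q) (hB₀ : 0 < B₀)
    (hD₀ : 0 < D₀) (ha : 0 < a) (ha1 : a < 1) (hb : 1 < b) :
    let β := (p - 2) / (q - p)
    let M := (D₀ * B₀ ^ β / sharpConst p q) ^ (1 / (β + 1))
    let g : ℝ → ℝ := fun x =>
      M * (1 / (β + 1) * ((1 - x) / D₀) + β / (β + 1) * ((x ^ q - 1) / B₀)) - (x ^ p - 1)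
    0 ≤ g a * (b ^ 2 - 1) + g b * (1 - a ^ 2) := by
  intro β M g
  obtain ⟨c, rfl⟩ : ∃ c, b = c⁻¹ := ⟨b⁻¹, (inv_inv b).symm⟩
  have hb0 : 0 < c⁻¹ := by linarith
  have hc : 0 < c := inv_pos.1 hb0
  have hc1 : c < 1 := by rwa [one_lt_inv₀ hc] at hb
  have hqp : 0 < q - p := by linarith
  have hβ : 0 ≤ β := div_nonneg (by linarith) hqp.le
  have hα : (q - 2) / (q - p) = β + 1 := by simp only [β]; field_simp; ring
  have hac : 0 < 1 - a ^ 2 * c ^ 2 := by nlinarith [mul_pos ha hc, show a * c < 1 by nlinarith]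
  have hac' : 0 < 1 - a * c := by nlinarith
  have ha' : 0 < 1 - a := by linarith
  have hc' : 0 < 1 - c := by linarith
  have hNp := twoPointNum_pos hp ha ha1 hc hc1
  have hNq := twoPointNum_pos (hp.trans hpq) ha ha1 hc hc1
  have hmp := twoPoint_moment_sub_one (s := p) ha ha1 hc hc1
  have hmq := twoPoint_moment_sub_one (s := q) ha ha1 hc hc1
  have hm1 := twoPoint_one_sub_mean ha ha1 hc hc1
  have hr := twoPoint_ratio_eq hp hpq ha ha1 hc hc1
  have hle := sharpConst_le hp hpq ha ha1 hc hc1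
  set A := c⁻¹ ^ (p - 2) * twoPointNum p a c / (1 - a ^ 2 * c ^ 2)
  set B := c⁻¹ ^ (q - 2) * twoPointNum q a c / (1 - a ^ 2 * c ^ 2)
  set D := (1 - c) * (1 - a) * (1 - a * c) / (1 - a ^ 2 * c ^ 2)
  have hA : 0 ≤ A := by positivity
  have hB : 0 ≤ B := by positivity
  have hD : 0 ≤ D := by positivity
  have hmain : sharpConst p q * A ^ (β + 1) ≤ D * B ^ β := by
    rw [← hα]
    exact (mul_le_mul_of_nonneg_right hle (by positivity)).trans hr.le
  have ht := le_tangent_of_mul_rpow_le hA hB hD (sharpConst_pos hp hpq) hβ hB₀ hD₀ hmain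
  have hd : 0 < c⁻¹ ^ 2 - a ^ 2 := by nlinarith
  have : g a * (c⁻¹ ^ 2 - 1) + g c⁻¹ * (1 - a ^ 2) =
      (c⁻¹ ^ 2 - a ^ 2) * (M * (1 / (β + 1) * (D / D₀) + β / (β + 1) * (B / B₀)) - A) := by
    simp only [g]
    linear_combination (M * (1 / (β + 1) / D₀)) * hm1 + (M * (β / (β + 1) / B₀)) * hmq - hmp
  rw [this]
  exact mul_nonneg hd.le (by linarith)

lemma mul_moment_rpow_le {Ω : Type*} [MeasurableSpace Ω] {μ : Measure Ω} [IsProbabilityMeasure μ]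
    {Y : Ω → ℝ} {p q : ℝ} (hp : 2 < p) (hpq : p < q) (hY : ∀ ω, 0 ≤ Y ω)
    (h1 : Integrable Y μ) (h2 : Integrable (fun ω => Y ω ^ 2) μ)
    (hYp : Integrable (fun ω => Y ω ^ p) μ) (hYq : Integrable (fun ω => Y ω ^ q) μ)
    (hY2 : ∫ ω, Y ω ^ 2 ∂μ = 1) (hD : 0 < 1 - ∫ ω, Y ω ∂μ)
    (hA : 0 ≤ ∫ ω, Y ω ^ p ∂μ - 1) (hB : 0 < ∫ ω, Y ω ^ q ∂μ - 1) :
    sharpConst p q * (∫ ω, Y ω ^ p ∂μ - 1) ^ ((q - 2) / (q - p)) ≤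
      (1 - ∫ ω, Y ω ∂μ) * (∫ ω, Y ω ^ q ∂μ - 1) ^ ((p - 2) / (q - p)) := by
  have htan := fun a b ha ha1 hb =>
    twoPoint_tangent (a := a) (b := b) hp hpq hB hD ha ha1 hb
  have hqp : 0 < q - p := by linarith
  have hC := sharpConst_pos hp hpq
  have hα : (q - 2) / (q - p) = (p - 2) / (q - p) + 1 := by field_simp; ring
  rw [hα]
  set β := (p - 2) / (q - p)
  have hβ : 0 ≤ β := div_nonneg (by linarith) hqp.le
  have hβ1 : 0 < β + 1 := by linarith
  set D₀ := 1 - ∫ ω, Y ω ∂μ with hD₀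
  set B₀ := ∫ ω, Y ω ^ q ∂μ - 1 with hB₀
  set A₀ := ∫ ω, Y ω ^ p ∂μ - 1 with hA₀
  set M := (D₀ * B₀ ^ β / sharpConst p q) ^ (1 / (β + 1)) with hM
  obtain ⟨ν, hν⟩ := exists_mul_sq_sub_one_le
    (g := fun x : ℝ =>
      M * (1 / (β + 1) * ((1 - x) / D₀) + β / (β + 1) * ((x ^ q - 1) / B₀)) - (x ^ p - 1))
    (by
      have e1 : ContinuousAt (fun x : ℝ => x ^ q) 0 :=
        Real.continuousAt_rpow_const _ _ (Or.inr (by linarith))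
      have e2 : ContinuousAt (fun x : ℝ => x ^ p) 0 :=
        Real.continuousAt_rpow_const _ _ (Or.inr (by linarith))
      fun_prop)
    (by simp) htan
  have hint1 : Integrable (fun ω => ν * (Y ω ^ 2 - 1)) μ :=
    (h2.sub (integrable_const _)).const_mul _
  have hi1 : Integrable (fun ω => 1 / (β + 1) * ((1 - Y ω) / D₀)) μ :=
    (((integrable_const _).sub h1).div_const _).const_mul _
  have hi2 : Integrable (fun ω => β / (β + 1) * ((Y ω ^ q - 1) / B₀)) μ :=
    ((hYq.sub (integrable_const _)).div_const _).const_mul _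
  have hi12 : Integrable (fun ω => 1 / (β + 1) * ((1 - Y ω) / D₀) +
      β / (β + 1) * ((Y ω ^ q - 1) / B₀)) μ := hi1.add hi2
  have hi3 : Integrable (fun ω => Y ω ^ p - 1) μ := hYp.sub (integrable_const _)
  have hle := integral_mono hint1 ((hi12.const_mul M).sub hi3) (fun ω => hν _ (hY ω))
  have el : ∫ ω, ν * (Y ω ^ 2 - 1) ∂μ = 0 := by
    rw [integral_const_mul, integral_sub h2 (integrable_const _), hY2]; simp
  -- At the point of tangency both normalised quotients have mean 1 and the weights sum to 1.
  have er : ∫ ω, (M * (1 / (β + 1) * ((1 - Y ω) / D₀) + β / (β + 1) * ((Y ω ^ q - 1) / B₀))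
      - (Y ω ^ p - 1)) ∂μ = M - A₀ := by
    rw [integral_sub (hi12.const_mul M) hi3, integral_const_mul, integral_add hi1 hi2,
      integral_const_mul, integral_const_mul, integral_div, integral_div,
      integral_sub (integrable_const _) h1, integral_sub hYq (integrable_const _),
      integral_sub hYp (integrable_const _)]
    simp only [integral_const, probReal_univ, smul_eq_mul, mul_one]
    rw [← hD₀, ← hB₀, ← hA₀]
    field_simp
    ring
  have hAM : A₀ ≤ M := by
    have h := hle.trans_eq er
    rw [el] at h
    linarith
  have := Real.rpow_le_rpow hA hAM hβ1.le
  rw [hM, ← Real.rpow_mul (by positivity), one_div_mul_cancel hβ1.ne', Real.rpow_one,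
    le_div_iff₀ hC] at this
  linarith

/-! ### From `eLpNorm` to real moments; the inequality -/

lemma eLpNorm_rpow_eq_ofReal_integral {Ω E : Type*} [MeasurableSpace Ω] [NormedAddCommGroup E]
    {μ : Measure Ω} {X : Ω → E} {s : ℝ} (hs : 0 < s) (hX : MemLp X (ENNReal.ofReal s) μ) :
    eLpNorm X (ENNReal.ofReal s) μ ^ s = ENNReal.ofReal (∫ ω, ‖X ω‖ ^ s ∂μ) := by
  have hs' : ENNReal.ofReal s ≠ 0 := by simpa using hs
  have h0 : 0 ≤ ∫ ω, ‖X ω‖ ^ s ∂μ := integral_nonneg fun ω => by positivity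
  rw [hX.eLpNorm_eq_integral_rpow_norm hs' ENNReal.ofReal_ne_top,
    ENNReal.toReal_ofReal hs.le, ENNReal.ofReal_rpow_of_nonneg (by positivity) hs.le,
    ← Real.rpow_mul h0, inv_mul_cancel₀ hs.ne', Real.rpow_one]

lemma momentQuotient_eq_ofReal {Ω E : Type*} [MeasurableSpace Ω] [NormedAddCommGroup E]
    {μ : Measure Ω} {X : Ω → E} {p q : ℝ} (hp : 2 < p) (hpq : p < q)
    (hXp : MemLp X (ENNReal.ofReal p) μ) (hXq : MemLp X (ENNReal.ofReal q) μ)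
    (hP : 0 ≤ ∫ ω, ‖X ω‖ ^ p ∂μ - 1) (hQ : 0 < ∫ ω, ‖X ω‖ ^ q ∂μ - 1) :
    momentQuotient p q X μ = ENNReal.ofReal ((∫ ω, ‖X ω‖ ^ p ∂μ - 1) ^ ((q - 2) / (q - p)) /
      (∫ ω, ‖X ω‖ ^ q ∂μ - 1) ^ ((p - 2) / (q - p))) := by
  have hqp : 0 < q - p := by linarith
  rw [momentQuotient, eLpNorm_rpow_eq_ofReal_integral (by linarith) hXp,
    eLpNorm_rpow_eq_ofReal_integral (by linarith) hXq, ← ENNReal.ofReal_one,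
    ← ENNReal.ofReal_sub _ zero_le_one, ← ENNReal.ofReal_sub _ zero_le_one,
    ENNReal.ofReal_rpow_of_nonneg hP (div_nonneg (by linarith) hqp.le),
    ENNReal.ofReal_rpow_of_nonneg hQ.le (div_nonneg (by linarith) hqp.le),
    ENNReal.ofReal_div_of_pos (by positivity)]

lemma momentQuotient_eq_zero_of_left {Ω E : Type*} [MeasurableSpace Ω] [NormedAddCommGroup E]
    {μ : Measure Ω} {X : Ω → E} {p q : ℝ} (hp : 2 < p) (hpq : p < q)
    (h : eLpNorm X (ENNReal.ofReal p) μ ≤ 1) : momentQuotient p q X μ = 0 := by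
  have : eLpNorm X (ENNReal.ofReal p) μ ^ p - 1 = 0 :=
    tsub_eq_zero_of_le (ENNReal.rpow_le_one h (by linarith))
  rw [momentQuotient, this, ENNReal.zero_rpow_of_pos (div_pos (by linarith) (by linarith)),
    ENNReal.zero_div]

lemma momentQuotient_eq_zero_of_right {Ω E : Type*} [MeasurableSpace Ω] [NormedAddCommGroup E]
    {μ : Measure Ω} {X : Ω → E} {p q : ℝ} (hp : 2 < p) (hpq : p < q)
    (h : eLpNorm X (ENNReal.ofReal q) μ = ∞) : momentQuotient p q X μ = 0 := by
  rw [momentQuotient, h, ENNReal.top_rpow_of_pos (by linarith), ENNReal.top_sub ENNReal.one_ne_top,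
    ENNReal.top_rpow_of_pos (div_pos (by linarith) (by linarith)), ENNReal.div_top]

theorem eLpNorm_one_add_mul_momentQuotient_le {Ω E : Type*} [MeasurableSpace Ω]
    [NormedAddCommGroup E] {μ : Measure Ω} [IsProbabilityMeasure μ] {X : Ω → E} {p q : ℝ}
    (hp : 2 < p) (hpq : p < q) (hX : AEStronglyMeasurable X μ) (hX2 : eLpNorm X 2 μ = 1) :
    eLpNorm X 1 μ + ENNReal.ofReal (sharpConst p q) * momentQuotient p q X μ ≤ 1 := by
  have h12 : eLpNorm X 1 μ ≤ 1 := 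
    (eLpNorm_le_eLpNorm_of_exponent_le one_le_two hX).trans_eq hX2
  have htwo : ENNReal.ofReal 2 = 2 := by simp
  have h2p : 2 ≤ ENNReal.ofReal p := htwo ▸ ENNReal.ofReal_le_ofReal hp.le
  have hpq' : ENNReal.ofReal p ≤ ENNReal.ofReal q := ENNReal.ofReal_le_ofReal hpq.le
  by_cases hq : eLpNorm X (ENNReal.ofReal q) μ = ∞
  · rw [momentQuotient_eq_zero_of_right hp hpq hq]; simpa using h12
  have hXq : MemLp X (ENNReal.ofReal q) μ := ⟨hX, lt_top_iff_ne_top.2 hq⟩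
  have hXp := hXq.mono_exponent hpq'
  have hXtwo := hXp.mono_exponent h2p
  have hXone := hXtwo.mono_exponent one_le_two
  have n2p : 1 ≤ eLpNorm X (ENNReal.ofReal p) μ :=
    hX2 ▸ eLpNorm_le_eLpNorm_of_exponent_le h2p hX
  by_cases hq1 : eLpNorm X (ENNReal.ofReal q) μ ≤ 1
  · rw [momentQuotient_eq_zero_of_left hp hpq
      ((eLpNorm_le_eLpNorm_of_exponent_le hpq' hX).trans hq1)]
    simpa using h12
  push Not at hq1
  have hi : ∀ s : ℝ, 0 < s → MemLp X (ENNReal.ofReal s) μ → Integrable (fun ω => ‖X ω‖ ^ s) μ :=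
    fun s hs h => by
      simpa [ENNReal.toReal_ofReal hs.le] using
        h.integrable_norm_rpow (by simpa using hs) ENNReal.ofReal_ne_top
  have hP : 0 ≤ ∫ ω, ‖X ω‖ ^ p ∂μ - 1 := by
    have := ENNReal.one_le_rpow n2p (show 0 < p by linarith)
    rw [eLpNorm_rpow_eq_ofReal_integral (by linarith) hXp, ENNReal.one_le_ofReal] at this
    linarith
  have hQ : 0 < ∫ ω, ‖X ω‖ ^ q ∂μ - 1 := by
    have := ENNReal.one_lt_rpow hq1 (show 0 < q by linarith)
    rw [eLpNorm_rpow_eq_ofReal_integral (by linarith) hXq, ENNReal.one_lt_ofReal] at this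
    linarith
  have hn1 : eLpNorm X 1 μ = ENNReal.ofReal (∫ ω, ‖X ω‖ ∂μ) := by
    have := eLpNorm_rpow_eq_ofReal_integral (μ := μ) (X := X) one_pos (by simpa using hXone)
    simpa using this
  have hsq : ∫ ω, ‖X ω‖ ^ 2 ∂μ = 1 := by
    have := eLpNorm_rpow_eq_ofReal_integral (μ := μ) (X := X) two_pos (by rwa [htwo])
    rw [htwo, hX2, ENNReal.one_rpow] at this
    simpa using (ENNReal.ofReal_eq_one.1 this.symm)
  have hint2 : Integrable (fun ω => ‖X ω‖ ^ 2) μ := by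
    simpa using hi 2 two_pos (by rwa [htwo])
  have hint1 : Integrable (fun ω => ‖X ω‖) μ := (memLp_one_iff_integrable.1 hXone).norm
  have hD : 0 ≤ 1 - ∫ ω, ‖X ω‖ ∂μ := by
    rw [hn1, ENNReal.ofReal_le_one] at h12; linarith
  have hint12 : Integrable (fun ω => ‖X ω‖ ^ 2 - 2 * ‖X ω‖) μ := hint2.sub (hint1.const_mul 2)
  -- Equality E|X| = 1 would give E(|X| - 1)² = 0, hence |X| = 1 almost surely, against ‖X‖_q > 1.
  have hD' : 0 < 1 - ∫ ω, ‖X ω‖ ∂μ := by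
    refine hD.lt_of_ne' fun h0 => hq1.ne' ?_
    have e : ∀ ω, (‖X ω‖ - 1) ^ 2 = ‖X ω‖ ^ 2 - 2 * ‖X ω‖ + 1 := fun ω => by ring
    have hz : ∫ ω, (‖X ω‖ - 1) ^ 2 ∂μ = 0 := by
      simp only [e]
      rw [integral_add hint12 (integrable_const _),
        integral_sub hint2 (hint1.const_mul 2), integral_const_mul, hsq]
      simp only [integral_const, probReal_univ, smul_eq_mul, mul_one]
      linarith
    have hiz : Integrable (fun ω => (‖X ω‖ - 1) ^ 2) μ := by
      simp only [e]
      exact hint12.add (integrable_const _)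
    rw [integral_eq_zero_iff_of_nonneg (fun ω => by positivity) hiz] at hz
    have hae : ∀ᵐ ω ∂μ, ‖X ω‖ = ‖(1 : ℝ)‖ := by
      filter_upwards [hz] with ω hω
      have := pow_eq_zero_iff (two_ne_zero) |>.1 hω
      rw [norm_one]; linarith
    rw [eLpNorm_congr_norm_ae (g := fun _ => (1 : ℝ)) hae,
      eLpNorm_const _ (by simpa using (show 0 < q by linarith)) (IsProbabilityMeasure.ne_zero μ)]
    simp
  have hmain := mul_moment_rpow_le hp hpq (fun ω => norm_nonneg (X ω)) hint1 hint2
    (hi p (by linarith) hXp) (hi q (by linarith) hXq) hsq hD' hP hQ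
  have hC := sharpConst_pos hp hpq
  rw [momentQuotient_eq_ofReal hp hpq hXp hXq hP hQ, hn1, ← ENNReal.ofReal_mul hC.le,
    ← ENNReal.ofReal_add (integral_nonneg fun ω => norm_nonneg _) (by positivity),
    ENNReal.ofReal_le_one]
  rw [← mul_div_assoc]
  have := div_le_of_le_mul₀ (by positivity) hD hmain
  linarith

/-! ### Sharpness and conclusion -/

/-- Two-point laws defeat every constant larger than `sharpConst p q`. -/
theorem exists_twoPoint_one_lt {p q C : ℝ} (hp : 2 < p) (hpq : p < q) (hC : sharpConst p q < C) :
    ∃ a b r : ℝ, 0 < a ∧ a < 1 ∧ 1 < b ∧ 0 < r ∧ r < 1 ∧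
      ∃ μ : Measure ℝ, IsProbabilityMeasure μ ∧
        μ = ENNReal.ofReal r • Measure.dirac a + ENNReal.ofReal (1 - r) • Measure.dirac b ∧
        eLpNorm (fun x : ℝ => x) 2 μ = 1 ∧
        1 < eLpNorm (fun x : ℝ => x) 1 μ +
          ENNReal.ofReal C * momentQuotient p q (fun x : ℝ => x) μ := by
  obtain ⟨⟨⟨a, ha, ha1⟩, c, hc, hc1⟩, hlt⟩ := exists_lt_of_ciInf_lt hC
  simp only at hlt
  have hb : 1 < c⁻¹ := (one_lt_inv₀ hc).2 hc1
  have hb0 : 0 < c⁻¹ := by linarith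
  have hd : 0 < c⁻¹ ^ 2 - a ^ 2 := by nlinarith
  have hb1 : 0 < c⁻¹ ^ 2 - 1 := by nlinarith
  have ha2 : 0 < 1 - a ^ 2 := by nlinarith
  -- The weight at a forced by second moment one.
  set r := (c⁻¹ ^ 2 - 1) / (c⁻¹ ^ 2 - a ^ 2) with hr
  have hr' : 1 - r = (1 - a ^ 2) / (c⁻¹ ^ 2 - a ^ 2) := by
    rw [hr, eq_div_iff hd.ne', sub_mul, div_mul_cancel₀ _ hd.ne']; ring
  have hrd : (c⁻¹ ^ 2 - a ^ 2) * r = c⁻¹ ^ 2 - 1 := by rw [hr, mul_div_cancel₀ _ hd.ne']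
  have hr0 : 0 < r := by positivity
  have hr1 : 0 < 1 - r := by rw [hr']; positivity
  refine ⟨a, c⁻¹, r, ha, ha1, hb, hr0, by linarith, _, ?_, rfl, ?_⟩
  · constructor
    simp only [Measure.add_apply, Measure.smul_apply, measure_univ, smul_eq_mul, mul_one]
    rw [← ENNReal.ofReal_add hr0.le hr1.le]; simp
  set μ := ENNReal.ofReal r • Measure.dirac a + ENNReal.ofReal (1 - r) • Measure.dirac c⁻¹ with hμ
  have hi1 : ∀ f : ℝ → ℝ, Integrable f (ENNReal.ofReal r • Measure.dirac a) := fun f =>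
    (integrable_dirac (by simp)).smul_measure ENNReal.ofReal_ne_top
  have hi2 : ∀ f : ℝ → ℝ, Integrable f (ENNReal.ofReal (1 - r) • Measure.dirac c⁻¹) := fun f =>
    (integrable_dirac (by simp)).smul_measure ENNReal.ofReal_ne_top
  have hint : ∀ f : ℝ → ℝ, ∫ x, f x ∂μ = r * f a + (1 - r) * f c⁻¹ := fun f => by
    rw [hμ, integral_add_measure (hi1 f) (hi2 f), integral_smul_measure, integral_smul_measure,
      integral_dirac, integral_dirac, ENNReal.toReal_ofReal hr0.le, ENNReal.toReal_ofReal hr1.le]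
    simp
  have hmem : ∀ s : ℝ, 0 < s → MemLp (fun x : ℝ => x) (ENNReal.ofReal s) μ := fun s hs => by
    rw [← integrable_norm_rpow_iff (by fun_prop) (by simpa using hs) ENNReal.ofReal_ne_top]
    exact (hi1 _).add_measure (hi2 _)
  have hmom : ∀ s : ℝ, ∫ x : ℝ, ‖x‖ ^ s ∂μ = r * a ^ s + (1 - r) * c⁻¹ ^ s := fun s => by
    rw [hint, Real.norm_of_nonneg ha.le, Real.norm_of_nonneg hb0.le]
  have hmom1 : ∀ s : ℝ, ∫ x : ℝ, ‖x‖ ^ s ∂μ - 1 =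
      c⁻¹ ^ (s - 2) * twoPointNum s a c / (1 - a ^ 2 * c ^ 2) := fun s => by
    rw [hmom, ← mul_right_inj' hd.ne', ← twoPoint_moment_sub_one ha ha1 hc hc1]
    linear_combination (a ^ s - c⁻¹ ^ s) * hrd
  have hac : 0 < 1 - a ^ 2 * c ^ 2 := by nlinarith [mul_pos ha hc, show a * c < 1 by nlinarith]
  have hac' : 0 < 1 - a * c := by nlinarith
  have ha' : 0 < 1 - a := by linarith
  have hc' : 0 < 1 - c := by linarith
  have hNp := twoPointNum_pos hp ha ha1 hc hc1
  have hNq := twoPointNum_pos (hp.trans hpq) ha ha1 hc hc1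
  have hA : 0 < ∫ x : ℝ, ‖x‖ ^ p ∂μ - 1 := by rw [hmom1]; positivity
  have hB : 0 < ∫ x : ℝ, ‖x‖ ^ q ∂μ - 1 := by rw [hmom1]; positivity
  have hmean : 1 - ∫ x : ℝ, ‖x‖ ^ (1 : ℝ) ∂μ =
      (1 - c) * (1 - a) * (1 - a * c) / (1 - a ^ 2 * c ^ 2) := by
    rw [hmom, Real.rpow_one, Real.rpow_one, ← mul_right_inj' hd.ne',
      ← twoPoint_one_sub_mean ha ha1 hc hc1]
    linear_combination (c⁻¹ - a) * hrd
  have hratio := twoPoint_ratio_eq hp hpq ha ha1 hc hc1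
  rw [← hmom1, ← hmom1, ← hmean] at hratio
  constructor
  · have h := eLpNorm_rpow_eq_ofReal_integral two_pos (hmem 2 two_pos)
    have h1 : ∫ x : ℝ, ‖x‖ ^ (2 : ℝ) ∂μ = 1 := by
      rw [hmom, Real.rpow_two, Real.rpow_two]
      linear_combination -hrd
    rw [h1, ENNReal.ofReal_one, ← ENNReal.one_rpow 2] at h
    simpa using ENNReal.rpow_left_injective two_ne_zero h
  · have h1 : eLpNorm (fun x : ℝ => x) 1 μ = ENNReal.ofReal (∫ x : ℝ, ‖x‖ ^ (1 : ℝ) ∂μ) := by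
      simpa using eLpNorm_rpow_eq_ofReal_integral one_pos (hmem 1 one_pos)
    have hC0 := (sharpConst_pos hp hpq).trans hC
    rw [h1, momentQuotient_eq_ofReal hp hpq (hmem p (by linarith)) (hmem q (by linarith)) hA.le hB,
      ← ENNReal.ofReal_mul hC0.le,
      ← ENNReal.ofReal_add (integral_nonneg fun x => by positivity) (by positivity),
      ENNReal.one_lt_ofReal, ← mul_div_assoc]
    have := mul_lt_mul_of_pos_right hlt (Real.rpow_pos_of_pos hA ((q - 2) / (q - p)))
    rw [hratio, ← lt_div_iff₀ (by positivity)] at this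
    linarith

theorem theorem1 :
    (∀ p q : ℝ, 2 < p → p < q →
      -- the constant is positive
      0 < sharpConst p q ∧
      -- the inequality, for every real or complex random variable
      (∀ (𝕜 : Type*) [RCLike 𝕜] [MeasurableSpace 𝕜] [BorelSpace 𝕜]
        (Ω : Type*) [MeasurableSpace Ω] (μ : Measure Ω) [IsProbabilityMeasure μ] (X : Ω → 𝕜),
        Measurable X → eLpNorm X 2 μ = 1 → eLpNorm X (ENNReal.ofReal p) μ < ∞ →
          eLpNorm X 1 μ + ENNReal.ofReal (sharpConst p q) * momentQuotient p q X μ ≤ 1) ∧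
      -- no larger constant works, already for random variables with two values
      (∀ C : ℝ, sharpConst p q < C →
        ∃ a b r : ℝ, 0 < a ∧ a < 1 ∧ 1 < b ∧ 0 < r ∧ r < 1 ∧
          ∃ μ : Measure ℝ, IsProbabilityMeasure μ ∧
            μ = ENNReal.ofReal r • Measure.dirac a + ENNReal.ofReal (1 - r) • Measure.dirac b ∧
            eLpNorm (fun x : ℝ => x) 2 μ = 1 ∧
            1 < eLpNorm (fun x : ℝ => x) 1 μ +
              ENNReal.ofReal C * momentQuotient p q (fun x : ℝ => x) μ) ∧
      -- the explicit lower bound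
      (min 1 (q - 2)) ^ ((p - 2) / (q - p)) / p ^ (2 * (q - 2) / (q - p)) ≤ sharpConst p q) ∧
    -- the exact value for the exponents 4 and 6
    sharpConst 4 6 = 1 / 3 := by

  refine ⟨fun p q hp hpq => ⟨sharpConst_pos hp hpq, ?_, fun C hC => exists_twoPoint_one_lt hp hpq hC,
    le_sharpConst hp hpq⟩, sharpConst_four_six⟩
  intro 𝕜 _ _ _ Ω _ μ _ X hX hX2 _
  exact eLpNorm_one_add_mul_momentQuotient_le hp hpq hX.aestronglyMeasurable hX2
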